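/- Let $\mathbb{F}_q$ be a finite field with $q$ elements, $k=\mathbb{F}_q(\theta)$, and let $|\cdot|_\infty$ be the absolute value on $k$ with $|f/g|_\infty=q^{\deg_\theta f-\deg_\theta g}$ for nonzero $f,g\in\mathbb{F}_q[\theta]$. Let $k_\infty$ be the completion of $k$, let $\mathbb{C}_\infty$ be the completion of an algebraic closure of $k_\infty$, and let $\overline{k}$ be the algebraic closure of $k$ inside $\mathbb{C}_\infty$. For $n\ge 1$ let $\mathbf{C}^{\otimes n}$ be the $n$-th tensor power of the Carlitz module, i.e. the $\mathbb{F}_q$-algebra homomorphism $[\cdot]_n:\mathbb{F}_q[t]\to\mathrm{Mat}_n(k[\tau])$ (with $\tau a=a^q\tau$) for which $[t]_n$ has entries $\theta$ on the diagonal and $1$ just above it, $\tau$ added to the entry in the lower left corner, and $0$ elsewhere. For $a\in\mathbb{F}_q[t]$ let $\partial[a]_n\in\mathrm{Mat}_n(k)$ be the constant term of $[a]_n$ in $\tau$. Let $\exp_{\mathbf{C}^{\otimes n}}$ be the unique series $\sum_{i\ge0}Q_i\tau^i$ with $Q_i\in\mathrm{Mat}_n(k)$, $Q_0=I_n$ and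 $[a]_n\circ\exp_{\mathbf{C}^{\otimes n}}=\exp_{\mathbf{C}^{\otimes n}}\circ\,\partial[a]_n$ for all $a\in\mathbb{F}_q[t]$. Let $\log_{\mathbf{C}^{\otimes n}}=\sum_{i\ge 0}P_i\tau^i$ be its formal inverse; it is evaluated at $x\in\mathbb{C}_\infty^n$ as $\sum_{i\ge 0}P_ix^{(q^i)}$, where $x^{(q^i)}$ is the vector of $q^i$-th powers. Put $L_0=1$, $L_i=(\theta-\theta^q)\cdots(\theta-\theta^{q^i})$ and $\mathrm{Li}_n(z)=\sum_{i\ge0}z^{q^i}/L_i^n$. Put $\mathbb{L}_0=1$, $\mathbb{L}_i=(t-\theta^q)\cdots(t-\theta^{q^i})$, and for $\mathbf{f}\in\mathbb{C}_\infty[t]$ let $\mathcal{L}_{\mathbf{f},n}(t)=\sum_{i\ge0}\mathbf{f}^{(i)}/\mathbb{L}_i^n\in\mathbb{C}_\infty[[t]]$ (with coefficientwise convergence), where $\mathbf{f}^{(i)}$ is obtained from $\mathbf{f}$ by raising every coefficient to the power $q^i$. Proposition. Let $n\ge 1$ and let $P=(p_{n-1},\dots,p_0)^{\mathrm{tr}}\in\mathbf{C}^{\otimes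 n}(\overline{k})=\overline{k}^{\,n}$ with $|p_j|_\infty<q^{-j+\frac{nq}{q-1}}$ for $0\le j\le n-1$. Put $\mathbf{f}_P=p_0+p_1(t-\theta)+\cdots+p_{n-1}(t-\theta)^{n-1}\in\overline{k}[t]$. Then the series $\log_{\mathbf{C}^{\otimes n}}(P)$, the series $\mathrm{Li}_n(\theta^mp_j)$ for $0\le m\le j\le n-1$, the series $\mathcal{L}_{\mathbf{f}_P,n}(t)$ in $\mathbb{C}_\infty[[t]]$, and its value $\mathcal{L}_{\mathbf{f}_P,n}(\theta)$ all converge, and the $n$-th (last) coordinate of $\log_{\mathbf{C}^{\otimes n}}(P)$ equals $$\sum_{j=1}^n\sum_{m=0}^{n-j}(-1)^m\binom{n-j}{m}\theta^{n-m-j}\,\mathrm{Li}_n(\theta^mp_{n-j})=\mathcal{L}_{\mathbf{f}_P,n}(\theta).$$ -/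

import Mathlib

noncomputable section

namespace Carlitz

open scoped NNReal Polynomial PowerSeries
open Finset Polynomial

/-! ### The fields `k_∞`, `ℂ_∞` and `k̄`

`F` is the finite field `𝔽_q`, with `q = Fintype.card F`, and `k = 𝔽_q(θ)` is `RatFunc F`, with
`θ = RatFunc.X`. -/

section Field

variable (F : Type*) [Field F]

/-- `k_∞`, the completion of `k = F(θ)` at the infinite place. -/
abbrev KInfty : Type _ :=
  letI : DecidableEq (RatFunc F) := Classical.decEq _
  RatFunc.CompletionAtInfty F

theorem KInfty.v_algebraMap (r : RatFunc F) (hr : r ≠ 0) :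
    Valued.v (algebraMap (RatFunc F) (KInfty F) r) = WithZero.exp r.intDegree := by
  classical
  refine ((RatFunc.valuedCompletionAtInfty.def F).trans
    ((RatFunc.inftyValued F).extensionValuation_apply_coe r)).trans ?_
  rw [RatFunc.inftyValued.def, RatFunc.inftyValuation_of_nonzero F hr]

variable [Fintype F]

/-- The rank one structure that sends `exp 1` to `q`, so that `|θ|_∞ = q`. -/
instance : (Valued.v (R := KInfty F) (Γ₀ := WithZero (Multiplicative ℤ))).RankOne where
  hom' := (WithZeroMulInt.toNNReal (e := (Fintype.card F : ℝ≥0))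
      (by exact_mod_cast Fintype.card_ne_zero)).comp
    MonoidWithZeroHom.ValueGroup₀.embedding
  strictMono' := (WithZeroMulInt.toNNReal_strictMono
      (by exact_mod_cast Fintype.one_lt_card)).comp
    MonoidWithZeroHom.ValueGroup₀.embedding_strictMono
  exists_val_nontrivial := by
    refine ⟨algebraMap (RatFunc F) (KInfty F) RatFunc.X, ?_⟩
    rw [KInfty.v_algebraMap F _ RatFunc.X_ne_zero]
    simp

instance : NontriviallyNormedField (KInfty F) :=
  Valued.toNontriviallyNormedField (KInfty F) (WithZero (Multiplicative ℤ))

/-- The normalization `|f/g|_∞ = q ^ (deg f - deg g)` on `k`. -/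
theorem KInfty.norm_algebraMap (r : RatFunc F) (hr : r ≠ 0) :
    ‖algebraMap (RatFunc F) (KInfty F) r‖ = (Fintype.card F : ℝ) ^ r.intDegree := by
  rw [Valued.toNormedField.norm_def]
  change ((WithZeroMulInt.toNNReal (e := (Fintype.card F : ℝ≥0))
    (by exact_mod_cast Fintype.card_ne_zero) (MonoidWithZeroHom.ValueGroup₀.embedding
    (Valuation.restrict _ _)) : ℝ≥0) : ℝ) = _
  rw [Valuation.embedding_restrict, KInfty.v_algebraMap F r hr,
    WithZeroMulInt.toNNReal_neg_apply _ WithZero.exp_ne_zero]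
  simp
  rfl

instance : IsUltrametricDist (KInfty F) := by
  open scoped Valued in exact inferInstance

instance : CompleteSpace (KInfty F) := by
  classical
  exact inferInstanceAs (CompleteSpace
    (@UniformSpace.Completion _ (RatFunc.inftyValued F).toUniformSpace))

/-- An algebraic closure of `k_∞`, with the unique extension of `|·|_∞`. -/
abbrev KInftyBar : Type _ := AlgebraicClosure (KInfty F)

instance : NontriviallyNormedField (KInftyBar F) :=
  spectralNorm.nontriviallyNormedField (KInfty F) (KInftyBar F)

/-- `ℂ_∞`, the completion of the algebraic closure of `k_∞`. Its norm is `|·|_∞`. -/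
def CInfty : Type _ := UniformSpace.Completion (KInftyBar F)

instance : NormedField (CInfty F) :=
  inferInstanceAs (NormedField (UniformSpace.Completion (KInftyBar F)))
instance : CompleteSpace (CInfty F) :=
  inferInstanceAs (CompleteSpace (UniformSpace.Completion (KInftyBar F)))

instance : Algebra (KInftyBar F) (CInfty F) :=
  inferInstanceAs (Algebra (KInftyBar F) (UniformSpace.Completion (KInftyBar F)))

/-- The embeddings `k → k_∞ → AlgebraicClosure k_∞ → ℂ_∞`. -/
instance : Algebra (RatFunc F) (CInfty F) :=
  ((algebraMap (KInftyBar F) (CInfty F)).comp (algebraMap (RatFunc F) (KInftyBar F))).toAlgebra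

instance : Algebra F (CInfty F) :=
  ((algebraMap (RatFunc F) (CInfty F)).comp (algebraMap F (RatFunc F))).toAlgebra

instance : IsScalarTower F (RatFunc F) (CInfty F) := .of_algebraMap_eq fun _ => rfl

theorem CInfty.norm_algebraMap (r : RatFunc F) (hr : r ≠ 0) :
    ‖algebraMap (RatFunc F) (CInfty F) r‖ = (Fintype.card F : ℝ) ^ r.intDegree := by
  rw [← KInfty.norm_algebraMap F r hr, ← spectralNorm_extends (K := KInfty F) (L := KInftyBar F)]
  exact UniformSpace.Completion.norm_coe _

/-- `k̄`, the algebraic closure of `k` inside `ℂ_∞`. -/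
abbrev KBar : IntermediateField (RatFunc F) (CInfty F) :=
  algebraicClosure (RatFunc F) (CInfty F)

/-- `θ`, as an element of `ℂ_∞`. -/
def theta : CInfty F := algebraMap (RatFunc F) (CInfty F) RatFunc.X

end Field

/-! ### Twisted power series -/

/-- The ring `R⟦τ⟧` of twisted power series `∑ aᵢ τⁱ` over `R`, with `τ a = φ(a) τ`. The twisted
polynomials `R[τ]` are the series with finitely many nonzero coefficients. For `R = Mat_d(K)` and
`φ` the entrywise `q`-th power, `∑ Qᵢ τⁱ` stands for the `𝔽_q`-linear power series
`z ↦ ∑ Qᵢ z^(qⁱ)` in `d` variables, and the product is composition. -/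
@[ext]
structure TwistedSeries {F R : Type*} [CommRing F] [Ring R] [Algebra F R] (φ : R →ₐ[F] R) where
  /-- The coefficient of `τ ^ i`. -/
  coeff : ℕ → R

namespace TwistedSeries

variable {F R : Type*} [CommRing F] [Ring R] [Algebra F R] {φ : R →ₐ[F] R}

instance : Zero (TwistedSeries φ) := ⟨⟨0⟩⟩
instance : One (TwistedSeries φ) := ⟨⟨Pi.single 0 1⟩⟩
instance : Add (TwistedSeries φ) := ⟨fun f g => ⟨f.coeff + g.coeff⟩⟩
instance : Neg (TwistedSeries φ) := ⟨fun f => ⟨-f.coeff⟩⟩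
/-- `(∑ aᵢ τⁱ) * (∑ bⱼ τʲ) = ∑ aᵢ φⁱ(bⱼ) τ^(i+j)`. -/
instance : Mul (TwistedSeries φ) :=
  ⟨fun f g => ⟨fun n => ∑ x ∈ antidiagonal n, f.coeff x.1 * (φ ^ x.1) (g.coeff x.2)⟩⟩

theorem coeff_zero (i : ℕ) : (0 : TwistedSeries φ).coeff i = 0 := rfl
theorem coeff_one (i : ℕ) : (1 : TwistedSeries φ).coeff i = if i = 0 then 1 else 0 := by
  change Pi.single (M := fun _ => R) 0 1 i = _
  rw [Pi.single_apply]
theorem coeff_add (f g : TwistedSeries φ) (i : ℕ) :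
    (f + g).coeff i = f.coeff i + g.coeff i := rfl
theorem coeff_neg (f : TwistedSeries φ) (i : ℕ) : (-f).coeff i = -f.coeff i := rfl
theorem coeff_mul (f g : TwistedSeries φ) (n : ℕ) :
    (f * g).coeff n = ∑ x ∈ antidiagonal n, f.coeff x.1 * (φ ^ x.1) (g.coeff x.2) := rfl

instance : Ring (TwistedSeries φ) where
  add_assoc f g h := by ext i; simp only [coeff_add, add_assoc]
  zero_add f := by ext i; simp only [coeff_add, coeff_zero, zero_add]
  add_zero f := by ext i; simp only [coeff_add, coeff_zero, add_zero]
  add_comm f g := by ext i; simp only [coeff_add, add_comm]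
  neg_add_cancel f := by ext i; simp only [coeff_add, coeff_neg, coeff_zero, neg_add_cancel]
  nsmul := nsmulRec
  zsmul := zsmulRec
  zero_mul f := by ext i; simp [coeff_mul, coeff_zero]
  mul_zero f := by ext i; simp [coeff_mul, coeff_zero]
  left_distrib f g h := by
    ext i; simp only [coeff_mul, coeff_add, map_add, mul_add, sum_add_distrib]
  right_distrib f g h := by
    ext i; simp only [coeff_mul, coeff_add, add_mul, sum_add_distrib]
  one_mul f := by
    ext i
    rw [coeff_mul, sum_eq_single (0, i)]
    · simp [coeff_one]
    · rintro ⟨a, b⟩ hx hne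
      rw [Finset.HasAntidiagonal.mem_antidiagonal] at hx
      have : a ≠ 0 := by rintro rfl; simp at hx; simp [hx] at hne
      simp [coeff_one, this]
    · simp
  mul_one f := by
    ext i
    rw [coeff_mul, sum_eq_single (i, 0)]
    · simp [coeff_one]
    · rintro ⟨a, b⟩ hx hne
      rw [Finset.HasAntidiagonal.mem_antidiagonal] at hx
      have : b ≠ 0 := by rintro rfl; simp at hx; simp [hx] at hne
      simp [coeff_one, this]
    · simp
  mul_assoc f g h := by
    ext i
    simp only [coeff_mul, sum_mul, map_sum, mul_sum]
    rw [sum_sigma', sum_sigma']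
    refine sum_nbij' (fun x => ⟨(x.2.1, x.2.2 + x.1.2), (x.2.2, x.1.2)⟩)
      (fun x => ⟨(x.1.1 + x.2.1, x.2.2), (x.1.1, x.2.1)⟩) ?_ ?_ ?_ ?_ ?_ <;>
    simp only [mem_sigma, Finset.HasAntidiagonal.mem_antidiagonal, Sigma.forall, Prod.forall] <;> 
    rintro a b c d ⟨rfl, rfl⟩ <;> simp [add_assoc, mul_assoc, pow_add]

/-- The constant series. -/
def C (φ : R →ₐ[F] R) : R →+* TwistedSeries φ where
  toFun r := ⟨Pi.single 0 r⟩
  map_zero' := by ext i; simp [coeff_zero]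
  map_one' := rfl
  map_add' r s := by ext i; simp [coeff_add, Pi.single_add]
  map_mul' r s := by
    ext i
    rw [coeff_mul]
    rcases eq_or_ne i 0 with rfl | hi
    · simp
    · rw [sum_eq_zero]
      · simp [hi]
      rintro ⟨a, b⟩ hx
      rw [Finset.HasAntidiagonal.mem_antidiagonal] at hx
      rcases eq_or_ne a 0 with rfl | ha
      · have : b ≠ 0 := by simpa [← hx] using hi
        simp [this]
      · simp [ha]

theorem coeff_C (r : R) (i : ℕ) : (C φ r).coeff i = if i = 0 then r else 0 := by
  change Pi.single (M := fun _ => R) 0 r i = _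
  rw [Pi.single_apply]

theorem coeff_mul_C (f : TwistedSeries φ) (r : R) (i : ℕ) :
    (f * C φ r).coeff i = f.coeff i * (φ ^ i) r := by
  rw [coeff_mul, sum_eq_single (i, 0)]
  · simp [coeff_C]
  · rintro ⟨a, b⟩ hx hne
    rw [Finset.HasAntidiagonal.mem_antidiagonal] at hx
    have : b ≠ 0 := by rintro rfl; simp at hx; simp [hx] at hne
    simp [coeff_C, this]
  · simp

theorem coeff_C_mul (f : TwistedSeries φ) (r : R) (i : ℕ) :
    (C φ r * f).coeff i = r * f.coeff i := by
  rw [coeff_mul, sum_eq_single (0, i)]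
  · simp [coeff_C]
  · rintro ⟨a, b⟩ hx hne
    rw [Finset.HasAntidiagonal.mem_antidiagonal] at hx
    have : a ≠ 0 := by rintro rfl; simp at hx; simp [hx] at hne
    simp [coeff_C, this]
  · simp

/-- The constants of `F` are central, as `φ` is `F`-linear. -/
instance : Algebra F (TwistedSeries φ) where
  algebraMap := (C φ).comp (algebraMap F R)
  smul c f := ⟨fun i => algebraMap F R c * f.coeff i⟩
  commutes' c f := by
    ext i
    simp [coeff_mul_C, coeff_C_mul, Algebra.commutes c]
  smul_def' c f := by
    ext i
    exact (coeff_C_mul f _ i).symm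

/-- The constant coefficient, `∑ aᵢ τⁱ ↦ a₀`. It is written `∂` for `t`-modules. -/
def constCoeff (φ : R →ₐ[F] R) : TwistedSeries φ →ₐ[F] R where
  toFun f := f.coeff 0
  map_zero' := rfl
  map_one' := by simp [coeff_one]
  map_add' _ _ := rfl
  map_mul' f g := by simp [coeff_mul]
  commutes' c := by simp [algebraMap, coeff_C]

/-- A left inverse of a series with constant coefficient `1`. -/
def leftInv (f : TwistedSeries φ) : ℕ → R
  | 0 => 1
  | n + 1 => -∑ i : Fin (n + 1), leftInv f i * (φ ^ (i : ℕ)) (f.coeff (n + 1 - i))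

theorem exists_mul_eq_one (f : TwistedSeries φ) (hf : f.coeff 0 = 1) :
    ∃ g : TwistedSeries φ, g.coeff 0 = 1 ∧ g * f = 1 := by
  refine ⟨⟨leftInv f⟩, by simp [leftInv], ?_⟩
  ext n
  rw [coeff_mul, coeff_one, Nat.sum_antidiagonal_eq_sum_range_succ_mk]
  cases n with
  | zero => simp [leftInv, hf]
  | succ n =>
    rw [sum_range_succ, sum_range]
    simp only [Nat.sub_self, hf, map_one, mul_one]
    rw [leftInv]
    simp

theorem isUnit_of_coeff_zero (f : TwistedSeries φ) (hf : f.coeff 0 = 1) : IsUnit f := by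
  obtain ⟨g, hg, hgf⟩ := exists_mul_eq_one f hf
  obtain ⟨h, -, hhg⟩ := exists_mul_eq_one g hg
  have : h = f := left_inv_eq_right_inv hhg hgf
  subst this
  exact ⟨⟨h, g, hhg, hgf⟩, rfl⟩

end TwistedSeries

section TensorPower


variable (F : Type*) [Field F] [Fintype F]

/-- The entrywise `q`-th power on `Mat_n(k)`. -/
abbrev matFrob (n : ℕ) :
    Matrix (Fin n) (Fin n) (RatFunc F) →ₐ[F] Matrix (Fin n) (Fin n) (RatFunc F) :=
  (FiniteField.frobeniusAlgHom F (RatFunc F)).mapMatrix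

/-- The nilpotent matrix with entries `1` just above the diagonal. -/
def shift (n : ℕ) : Matrix (Fin n) (Fin n) (RatFunc F) :=
  Matrix.of fun i j => if (i : ℕ) + 1 = j then 1 else 0

/-- The matrix with entry `1` in the lower left corner. -/
def corner (n : ℕ) : Matrix (Fin n) (Fin n) (RatFunc F) :=
  Matrix.of fun i j => if (i : ℕ) + 1 = n ∧ (j : ℕ) = 0 then 1 else 0

/-- `[t]_n`: `θ` on the diagonal, `1` just above it, and `τ` added in the lower left corner. -/
def carlitzT (n : ℕ) : TwistedSeries (matFrob F n) where
  coeff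
    | 0 => Matrix.scalar (Fin n) (RatFunc.X : RatFunc F) + shift F n
    | 1 => corner F n
    | _ => 0

/-- The `n`-th tensor power `C^{⊗n}` of the Carlitz module: the `𝔽_q`-algebra homomorphism
`[·]_n : 𝔽_q[t] → Mat_n(k)[τ] ⊆ Mat_n(k)⟦τ⟧` determined by `[t]_n`. -/
def carlitzTensor (n : ℕ) : F[X] →ₐ[F] TwistedSeries (matFrob F n) := aeval (carlitzT F n)

/-- `e` is the exponential series of the `t`-module `ρ`: `e = 1 + ∑_{i ≥ 1} Qᵢ τⁱ` and
`ρ_a ∘ e = e ∘ ∂ρ_a` for all `a ∈ 𝔽_q[t]`. -/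
structure IsExp {F R : Type*} [Field F] [Ring R] [Algebra F R] {φ : R →ₐ[F] R}
    (ρ : F[X] →ₐ[F] TwistedSeries φ) (e : TwistedSeries φ) : Prop where
  coeff_zero : e.coeff 0 = 1
  functional_equation : ∀ a : F[X],
    ρ a * e = e * TwistedSeries.C φ (TwistedSeries.constCoeff φ (ρ a))

variable {F}

theorem isNilpotent_shift (n : ℕ) : IsNilpotent (shift F n) := by
  have h : (shift F n).charpoly = X ^ n := by
    rw [Matrix.charpoly_of_isUpperTriangular]
    · simp [shift]
    · intro i j hij
      have : (j : ℕ) < i := hij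
      simp only [shift, Matrix.of_apply, ite_eq_right_iff]
      omega
  refine ⟨n, ?_⟩
  have := Matrix.aeval_self_charpoly (shift F n)
  simpa [h] using this

theorem matFrob_pow_apply (n i : ℕ) (M : Matrix (Fin n) (Fin n) (RatFunc F)) :
    (matFrob F n ^ i) M = M.map (· ^ Fintype.card F ^ i) := by
  induction i with
  | zero => ext; simp
  | succ i ih =>
    rw [pow_succ', AlgHom.mul_apply, ih]
    ext
    simp [pow_succ, pow_mul]

theorem theta_pow_ne (i : ℕ) :
    (RatFunc.X : RatFunc F) ^ Fintype.card F ^ (i + 1) - RatFunc.X ≠ 0 := by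
  rw [sub_ne_zero, ← RatFunc.algebraMap_X, ← map_pow, (RatFunc.algebraMap_injective F).ne_iff]
  intro h
  have h1 := congrArg natDegree h
  rw [natDegree_X_pow, natDegree_X] at h1
  exact (Nat.one_lt_pow (by simp) (Fintype.one_lt_card (α := F))).ne' h1

theorem bijective_step (n i : ℕ) : Function.Bijective
    fun M : Matrix (Fin n) (Fin n) (RatFunc F) =>
      M * (matFrob F n ^ (i + 1)) ((carlitzT F n).coeff 0) - (carlitzT F n).coeff 0 * M := by
  set c := (RatFunc.X : RatFunc F) ^ Fintype.card F ^ (i + 1) - RatFunc.X with hc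
  have hN := isNilpotent_shift (F := F) n
  have hnil : IsNilpotent (LinearMap.mulRight (RatFunc F) (shift F n) -
      LinearMap.mulLeft (RatFunc F) (shift F n)) :=
    (LinearMap.commute_mulLeft_right _ _).symm.isNilpotent_sub
      ((LinearMap.isNilpotent_mulRight_iff _ _).2 hN)
      ((LinearMap.isNilpotent_mulLeft_iff _ _).2 hN)
  have hu : IsUnit (algebraMap (RatFunc F)
      (Module.End (RatFunc F) (Matrix (Fin n) (Fin n) (RatFunc F))) c) :=
    (isUnit_iff_ne_zero.2 (theta_pow_ne i)).map _
  have := hnil.isUnit_add_left_of_commute hu (Algebra.commutes _ _).symm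
  convert (Module.End.isUnit_iff _).1 this using 1
  funext M
  have h1 : (matFrob F n ^ (i + 1)) ((carlitzT F n).coeff 0) =
      Matrix.scalar (Fin n) ((RatFunc.X : RatFunc F) ^ Fintype.card F ^ (i + 1)) + shift F n := by
    change (matFrob F n ^ (i + 1)) (Matrix.scalar (Fin n) (RatFunc.X : RatFunc F) + shift F n) = _
    rw [map_add, matFrob_pow_apply, matFrob_pow_apply]
    congr 1
    · ext a b
      by_cases hab : a = b <;> simp [hab]
    · ext a b
      simp [shift]
  have h2 : (carlitzT F n).coeff 0 = 
    Matrix.scalar (Fin n) (RatFunc.X : RatFunc F) + shift F n := rfl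
  have h3 (x : RatFunc F) : Matrix.scalar (Fin n) x = algebraMap _ _ x := rfl
  rw [h1, h2, h3, h3]
  simp only [mul_add, add_mul, LinearMap.add_apply, LinearMap.sub_apply, hc, 
    LinearMap.mulRight_apply, LinearMap.mulLeft_apply, Module.algebraMap_end_apply,
    Algebra.smul_def, map_sub]
  rw [← Algebra.commutes _ M]
  abel

theorem coeff_carlitzT_mul (n i : ℕ) (e : TwistedSeries (matFrob F n)) :
    (carlitzT F n * e).coeff (i + 1) =
      (carlitzT F n).coeff 0 * e.coeff (i + 1) + corner F n * matFrob F n (e.coeff i) := by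
  rw [TwistedSeries.coeff_mul, Nat.sum_antidiagonal_eq_sum_range_succ_mk, sum_range_succ',
    sum_range_succ']
  rw [sum_eq_zero]
  · simp [carlitzT, add_comm]
  · intro k _
    simp [carlitzT]

theorem functional_equation_of_t (n : ℕ) {e : TwistedSeries (matFrob F n)}
    (h : carlitzT F n * e = e * TwistedSeries.C _ ((carlitzT F n).coeff 0)) (a : F[X]) :
    carlitzTensor F n a * e =
      e * TwistedSeries.C _ (TwistedSeries.constCoeff _ (carlitzTensor F n a)) := by
  induction a using Polynomial.induction_on' with
  | add p q hp hq => simp only [map_add, add_mul, mul_add, hp, hq]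
  | monomial m c =>
    have hc (c : F) : TwistedSeries.C (matFrob F n) (algebraMap F _ c) = algebraMap F _ c := rfl
    have ht : TwistedSeries.constCoeff _ (carlitzT F n) = (carlitzT F n).coeff 0 := rfl
    simp only [carlitzTensor, aeval_monomial, map_mul, map_pow, AlgHom.commutes, hc, ht]
    have : SemiconjBy e (TwistedSeries.C _ ((carlitzT F n).coeff 0)) (carlitzT F n) := h.symm
    have hs : SemiconjBy e (algebraMap F _ c) (algebraMap F _ c) := (Algebra.commutes c e).symm
    exact (hs.mul_right (this.pow_right m)).eq.symm

variable (F)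

theorem existsUnique_isExp (n : ℕ) : ∃! e, IsExp (carlitzTensor F n) e := by
  have key (e : TwistedSeries (matFrob F n)) : IsExp (carlitzTensor F n) e ↔
      e.coeff 0 = 1 ∧ ∀ i, e.coeff (i + 1) * (matFrob F n ^ (i + 1)) ((carlitzT F n).coeff 0) -
        (carlitzT F n).coeff 0 * e.coeff (i + 1) = corner F n * matFrob F n (e.coeff i) := by
    constructor
    · rintro ⟨h0, h⟩
      refine ⟨h0, fun i => ?_⟩
      have := congrArg (fun f => f.coeff (i + 1)) (h X)
      simp only [carlitzTensor, aeval_X, coeff_carlitzT_mul, TwistedSeries.coeff_mul_C] at this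
      exact sub_eq_of_eq_add' this.symm
    · rintro ⟨h0, h⟩
      refine ⟨h0, functional_equation_of_t n ?_⟩
      ext1
      funext i
      cases i with
      | zero => simp [TwistedSeries.coeff_mul, TwistedSeries.coeff_C, h0]
      | succ i =>
        rw [coeff_carlitzT_mul, TwistedSeries.coeff_mul_C, ← h i]
        abel
  choose s hs using fun i M => (bijective_step (F := F) n i).surjective (corner F n * M)
  refine ⟨⟨fun i => Nat.rec 1 (fun i M => s i (matFrob F n M)) i⟩, (key _).2 ⟨rfl, ?_⟩, ?_⟩
  · intro i
    exact hs i _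
  · intro e he
    obtain ⟨h0, h⟩ := (key e).1 he
    ext1
    funext i
    induction i with
    | zero => exact h0
    | succ i ih =>
      refine (bijective_step (F := F) n i).injective ?_
      refine (h i).trans ?_
      rw [ih]
      exact (hs i _).symm

/-- The exponential series `exp_{C^{⊗n}}`. -/
def expSeries (n : ℕ) : TwistedSeries (matFrob F n) := (existsUnique_isExp F n).choose

theorem isExp_expSeries (n : ℕ) : IsExp (carlitzTensor F n) (expSeries F n) :=
  (existsUnique_isExp F n).choose_spec.1

/-- The logarithm series `log_{C^{⊗n}}`, the formal inverse of the exponential series. -/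
def logSeries (n : ℕ) : TwistedSeries (matFrob F n) := Ring.inverse (expSeries F n)

theorem logSeries_mul_expSeries (n : ℕ) : logSeries F n * expSeries F n = 1 :=
  Ring.inverse_mul_cancel _ (TwistedSeries.isUnit_of_coeff_zero _ (isExp_expSeries F n).coeff_zero)

theorem expSeries_mul_logSeries (n : ℕ) : expSeries F n * logSeries F n = 1 :=
  Ring.mul_inverse_cancel _ (TwistedSeries.isUnit_of_coeff_zero _ (isExp_expSeries F n).coeff_zero)

end TensorPower

/-! ### Logarithms and polylogarithms on `ℂ_∞` -/

section Analytic

variable (F : Type*) [Field F] [Fintype F]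

/-- The `i`-th term `Pᵢ x^(qⁱ)` of `log_{C^{⊗n}}(x)`. -/
def logTerm (n : ℕ) (x : Fin n → CInfty F) (i : ℕ) : Fin n → CInfty F :=
  Matrix.mulVec (((logSeries F n).coeff i).map (algebraMap (RatFunc F) (CInfty F)))
    (fun s => x s ^ Fintype.card F ^ i)

/-- `log_{C^{⊗n}}(x)`, for `x` at which the series converges. -/
def log (n : ℕ) (x : Fin n → CInfty F) : Fin n → CInfty F := ∑' i, logTerm F n x i

/-- `L_i = (θ - θ^q) ⋯ (θ - θ^(q^i))`. -/
def bigL (i : ℕ) : CInfty F :=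
  ∏ j ∈ Icc 1 i, (theta F - theta F ^ Fintype.card F ^ j)

/-- The `i`-th term `z^(q^i) / L_i^n` of the `n`-th Carlitz polylogarithm. -/
def polylogTerm (n : ℕ) (z : CInfty F) (i : ℕ) : CInfty F :=
  z ^ Fintype.card F ^ i / bigL F i ^ n

/-- The `n`-th Carlitz polylogarithm `Li_n(z)`, for `z` at which the series converges. -/
def polylog (n : ℕ) (z : CInfty F) : CInfty F := ∑' i, polylogTerm F n z i

/-- `𝕃_i = (t - θ^q) ⋯ (t - θ^(q^i))`. -/
def motivicL (i : ℕ) : (CInfty F)[X] :=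
  ∏ j ∈ Icc 1 i, (X - C (theta F ^ Fintype.card F ^ j))

variable {F}

/-- The `i`-th Frobenius twist `f^(i)`: every coefficient is raised to the power `q^i`. -/
def twist (f : (CInfty F)[X]) (i : ℕ) : (CInfty F)[X] :=
  f.map (FiniteField.frobeniusAlgHom F (CInfty F) ^ i : CInfty F →ₐ[F] CInfty F).toRingHom

/-- The `i`-th term `f^(i) / 𝕃_i^n` of `𝓛_{f,n}`, as a power series in `t`. -/
def motivicTerm (f : (CInfty F)[X]) (n i : ℕ) : (CInfty F)⟦X⟧ :=
  (twist f i : (CInfty F)⟦X⟧) * ((motivicL F i : (CInfty F)⟦X⟧) ^ n)⁻¹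

open scoped PowerSeries.WithPiTopology in
/-- `𝓛_{f,n}(t) = ∑ f^(i) / 𝕃_i^n` in `ℂ_∞⟦t⟧`, where convergence is coefficientwise. -/
def motivicSeries (f : (CInfty F)[X]) (n : ℕ) : (CInfty F)⟦X⟧ := ∑' i, motivicTerm f n i

/-- The `m`-th term `g_m θ^m` of the value of `g = ∑ g_m t^m` at `t = θ`. -/
def evalThetaTerm (g : (CInfty F)⟦X⟧) (m : ℕ) : CInfty F := PowerSeries.coeff m g * theta F ^ m

/-- The value at `t = θ` of a power series that converges there. -/
def evalTheta (g : (CInfty F)⟦X⟧) : CInfty F := ∑' m, evalThetaTerm g m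

/-- The point `P = (p_{n-1}, …, p_0)` of `C^{⊗n}(k̄)`. -/
def point (n : ℕ) (p : ℕ → KBar F) : Fin n → KBar F := fun i => p (n - 1 - i)

/-- `f_P = p_0 + p_1 (t - θ) + ⋯ + p_{n-1} (t - θ)^(n-1)`. -/
def pointPoly (n : ℕ) (p : ℕ → KBar F) : (KBar F)[X] :=
  ∑ j ∈ range n, C (p j) * (X - C (algebraMap (RatFunc F) (KBar F) RatFunc.X)) ^ j

end Analytic

end Carlitz

end

/-! All three quantities equal the series `∑ i, f^(i)(θ) / L_i^n`, where `f = ∑ p_j (t - θ)^j`,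
hence `f^(i)(θ) = ∑ p_j^(q^i) (θ - θ^(q^i))^j`.

For the logarithm, inverting the functional equation of the exponential gives `log ∘ [t] = ∂[t] ∘
log`, a recursion for the matrices `P_i`. In the last row it closes up and is solved by `(θ -
θ^(q^i))^(n-1-b) / L_i^n` in column `b` (`logEntry_last`). For the polylogarithms, the binomial
theorem expands `(θ - θ^(q^i))^j`, and the powers of `θ^(q^i)` are absorbed into the argument of
`Li_n` (`sum_smul_polylogTerm`). For the deformation series, each term is evaluated at `t = θ`,
where `𝕃_i` becomes `L_i`, and the sums over `i` and over powers of `t` are exchanged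
(`InLogDomain.evalTheta_motivicSeries`).

Convergence rests on one identity: with `r = q^(q/(q-1))`, one has `r^(q^i) = r |L_i|`. So `a^(q^i)
/ |L_i|^n = r^n (a / r^n)^(q^i)` is summable when `0 ≤ a < r^n`, and the hypothesis on `p_j` says
exactly that `a = |p_j| q^j` qualifies. -/

noncomputable section

namespace Carlitz

open scoped NNReal Polynomial PowerSeries
open Finset Polynomial

/-! ### Absolute values in `ℂ_∞` and the radius of convergence -/

section Norm

instance {E : Type*} [SeminormedAddCommGroup E] [IsUltrametricDist E] :
    IsUltrametricDist (UniformSpace.Completion E) := by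
  refine IsUltrametricDist.isUltrametricDist_of_forall_norm_add_le_max_norm fun x y => ?_
  induction x, y using UniformSpace.Completion.induction_on₂ with
  | hp => exact isClosed_le (by fun_prop) (by fun_prop)
  | ih x y =>
    rw [← UniformSpace.Completion.coe_add]
    simp only [UniformSpace.Completion.norm_coe]
    exact IsUltrametricDist.norm_add_le_max x y

variable (F : Type*) [Field F] [Fintype F]

instance : IsUltrametricDist (KInftyBar F) :=
  IsUltrametricDist.isUltrametricDist_of_forall_norm_add_le_max_norm
    (isNonarchimedean_spectralNorm (K := KInfty F) (L := KInftyBar F))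

instance : IsUltrametricDist (CInfty F) :=
  inferInstanceAs (IsUltrametricDist (UniformSpace.Completion (KInftyBar F)))

theorem norm_theta : ‖theta F‖ = Fintype.card F := by
  rw [theta, CInfty.norm_algebraMap F _ RatFunc.X_ne_zero, RatFunc.intDegree_X, zpow_one]

theorem one_lt_card_real : (1 : ℝ) < Fintype.card F := by
  exact_mod_cast Fintype.one_lt_card

theorem norm_theta_sub_pow {i : ℕ} (hi : i ≠ 0) :
    ‖theta F - theta F ^ Fintype.card F ^ i‖ = (Fintype.card F : ℝ) ^ Fintype.card F ^ i := by
  have hlt : (Fintype.card F : ℝ) < (Fintype.card F : ℝ) ^ Fintype.card F ^ i :=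
    lt_self_pow₀ (one_lt_card_real F) (Nat.one_lt_pow hi Fintype.one_lt_card)
  rw [sub_eq_add_neg, IsUltrametricDist.norm_add_eq_max_of_norm_ne_norm] <;>
    rw [norm_neg, norm_pow, norm_theta]
  · exact max_eq_right hlt.le
  · exact hlt.ne

theorem bigL_succ (i : ℕ) :
    bigL F (i + 1) = bigL F i * (theta F - theta F ^ Fintype.card F ^ (i + 1)) :=
  prod_Icc_succ_top (by lia) _

theorem norm_bigL_pos (i : ℕ) : 0 < ‖bigL F i‖ := by
  rw [bigL, norm_prod]
  refine prod_pos fun j hj => ?_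
  rw [norm_theta_sub_pow F (by simp at hj; lia)]
  have := one_lt_card_real F
  positivity

theorem bigL_ne_zero (i : ℕ) : bigL F i ≠ 0 := norm_pos_iff.1 (norm_bigL_pos F i)

/-- The radius of convergence `q ^ (q / (q - 1))` of the Carlitz logarithm. -/
def logRadius : ℝ :=
  (Fintype.card F : ℝ) ^ ((Fintype.card F : ℝ) / ((Fintype.card F : ℝ) - 1))

theorem logRadius_pos : 0 < logRadius F :=
  Real.rpow_pos_of_pos (zero_lt_one.trans (one_lt_card_real F)) _

theorem logRadius_pow_card :
    logRadius F ^ Fintype.card F = logRadius F * (Fintype.card F : ℝ) ^ Fintype.card F := by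
  have h1 := one_lt_card_real F
  have h0 : (0 : ℝ) < Fintype.card F := zero_lt_one.trans h1
  rw [logRadius, ← Real.rpow_natCast _ (Fintype.card F), ← Real.rpow_natCast _ (Fintype.card F),
    ← Real.rpow_mul h0.le, ← Real.rpow_add h0]
  congr 1
  have : (Fintype.card F : ℝ) - 1 ≠ 0 := by linarith
  field_simp
  ring

/-- The `i`-th factor of `L_i` has norm `q^(q^i)`, which is what raising `r^q = r q^q` to the power
`q^(i-1)` contributes. -/
theorem logRadius_pow (i : ℕ) :
    logRadius F ^ Fintype.card F ^ i = logRadius F * ‖bigL F i‖ := by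
  induction i with
  | zero => simp [bigL]
  | succ i ih =>
    rw [bigL_succ, norm_mul, norm_theta_sub_pow F i.succ_ne_zero, ← mul_assoc, ← ih, pow_succ',
      pow_mul, logRadius_pow_card, mul_pow, pow_mul]

theorem summable_pow_div_norm_bigL (n : ℕ) {a : ℝ} (ha : 0 ≤ a) (h : a < logRadius F ^ n) :
    Summable fun i => a ^ Fintype.card F ^ i / ‖bigL F i‖ ^ n := by
  have hr := pow_pos (logRadius_pos F) n
  have hy : a / logRadius F ^ n < 1 := (div_lt_one hr).2 h
  have hy0 : 0 ≤ a / logRadius F ^ n := div_nonneg ha hr.le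
  have hs : Summable fun i : ℕ => (a / logRadius F ^ n) ^ i * logRadius F ^ n :=
    (summable_geometric_of_lt_one hy0 hy).mul_right _
  refine hs.of_nonneg_of_le (fun i => by positivity) fun i => ?_
  have hL := pow_pos (norm_bigL_pos F i) n
  calc a ^ Fintype.card F ^ i / ‖bigL F i‖ ^ n
      = (a / logRadius F ^ n) ^ Fintype.card F ^ i * logRadius F ^ n := by
        rw [div_pow, ← pow_mul, mul_comm n, pow_mul, logRadius_pow, mul_pow]
        field_simp
    _ ≤ _ := by
        gcongr ?_ * _
        -- Since `i < q^i`, a geometric series dominates.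
        exact pow_le_pow_of_le_one hy0 hy.le (Nat.lt_pow_self Fintype.one_lt_card).le

/-- Puts the hypothesis on `|p_j|` into the form in which every convergence proof uses it. -/
theorem mul_pow_lt_logRadius_pow (n j : ℕ) {a : ℝ}
    (h : a < (Fintype.card F : ℝ) ^
      (-(j : ℝ) + n * Fintype.card F / ((Fintype.card F : ℝ) - 1))) :
    a * (Fintype.card F : ℝ) ^ j < logRadius F ^ n := by
  have h0 : (0 : ℝ) < Fintype.card F := zero_lt_one.trans (one_lt_card_real F)
  have := mul_lt_mul_of_pos_right h (pow_pos h0 j)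
  rwa [← Real.rpow_natCast _ j, ← Real.rpow_add h0, neg_add_cancel_comm, mul_comm (n : ℝ),
    mul_div_right_comm, Real.rpow_mul_natCast h0.le, Real.rpow_natCast] at this

end Norm

/-! ### The coefficients of the logarithm -/

section LogCoeff

variable (F : Type*) [Field F] [Fintype F]

theorem logSeries_coeff_zero (n : ℕ) : (logSeries F n).coeff 0 = 1 := by
  have := congrArg (fun f => f.coeff 0) (logSeries_mul_expSeries F n)
  simpa [TwistedSeries.coeff_mul, TwistedSeries.coeff_one, (isExp_expSeries F n).coeff_zero]
    using this

theorem logSeries_mul_carlitzT (n : ℕ) :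
    logSeries F n * carlitzT F n =
      TwistedSeries.C _ ((carlitzT F n).coeff 0) * logSeries F n := by
  have h : carlitzT F n * expSeries F n =
      expSeries F n * TwistedSeries.C _ ((carlitzT F n).coeff 0) := by
    have := (isExp_expSeries F n).functional_equation X
    rwa [carlitzTensor, aeval_X] at this
  calc logSeries F n * carlitzT F n
      = logSeries F n * (carlitzT F n * expSeries F n) * logSeries F n := by
        rw [mul_assoc, mul_assoc, expSeries_mul_logSeries, mul_one]
    _ = _ := by rw [h, ← mul_assoc, logSeries_mul_expSeries, one_mul]

/-- With `N` the shift and `E` the corner matrix, both fixed by Frobenius, comparing coefficients of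
`τ^(i+1)` in `log ∘ [t] = ∂[t] ∘ log` gives `(θ - θ^(q^(i+1))) P_(i+1) = P_(i+1) N - N P_(i+1) + P_i
E`; this is its entry `(a, b)`. -/
theorem logSeries_coeff_succ (n i : ℕ) (a b : Fin n) :
    ((RatFunc.X : RatFunc F) - RatFunc.X ^ Fintype.card F ^ (i + 1)) *
        (logSeries F n).coeff (i + 1) a b =
      (∑ c : Fin n, if (c : ℕ) + 1 = b then (logSeries F n).coeff (i + 1) a c else 0) -
      (∑ c : Fin n, if (a : ℕ) + 1 = c then (logSeries F n).coeff (i + 1) c b else 0) +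
      ∑ c : Fin n, if (c : ℕ) + 1 = n ∧ (b : ℕ) = 0 then (logSeries F n).coeff i a c else 0 := by
  have h := congrArg (fun f => f.coeff (i + 1) a b) (logSeries_mul_carlitzT F n)
  have h1 : (logSeries F n * carlitzT F n).coeff (i + 1) =
      (logSeries F n).coeff (i + 1) * ((matFrob F n ^ (i + 1)) ((carlitzT F n).coeff 0)) +
      (logSeries F n).coeff i * ((matFrob F n ^ i) (corner F n)) := by
    rw [TwistedSeries.coeff_mul, Nat.sum_antidiagonal_eq_sum_range_succ_mk, sum_range_succ,
      sum_range_succ, sum_eq_zero]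
    · simp [carlitzT, add_comm]
    · intro k hk
      have : k < i := mem_range.1 hk
      obtain ⟨l, hl⟩ : ∃ l, i + 1 - k = l + 2 := ⟨i - 1 - k, by lia⟩
      simp [carlitzT, hl]
  have h2 : (carlitzT F n).coeff 0 =
    Matrix.scalar (Fin n) (RatFunc.X : RatFunc F) + shift F n := rfl
  have h3 (x : RatFunc F) (M : Matrix (Fin n) (Fin n) (RatFunc F)) :
      (Matrix.scalar (Fin n) x * M) a b = x * M a b := by
    simp [Matrix.scalar_apply, Matrix.diagonal_mul]
  have h4 (x : RatFunc F) (M : Matrix (Fin n) (Fin n) (RatFunc F)) :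
      (M * Matrix.scalar (Fin n) x) a b = x * M a b := by
    simp [Matrix.scalar_apply, Matrix.mul_diagonal, mul_comm]
  have h5 (j : ℕ) : (matFrob F n ^ j) (Matrix.scalar (Fin n) (RatFunc.X : RatFunc F)) =
      Matrix.scalar (Fin n) ((RatFunc.X : RatFunc F) ^ Fintype.card F ^ j) := by
    rw [matFrob_pow_apply]
    ext a b
    by_cases hab : a = b <;> simp [hab]
  have h6 (j : ℕ) : (matFrob F n ^ j) (shift F n) = shift F n := by
    rw [matFrob_pow_apply]
    ext a b
    simp [shift]
  have h7 (j : ℕ) : (matFrob F n ^ j) (corner F n) = corner F n := by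
    rw [matFrob_pow_apply]
    ext a b
    simp [corner]
  simp only [h1, TwistedSeries.coeff_C_mul] at h
  simp only [h2, map_add, h5, h6, h7, mul_add, add_mul,
    Matrix.add_apply, h3, h4] at h
  simp only [Matrix.mul_apply, shift, corner, Matrix.of_apply, mul_ite, ite_mul, mul_one, mul_zero,
    one_mul, zero_mul] at h
  linear_combination -h

/-- The entries of `Pᵢ`, as elements of `ℂ_∞`. -/
def logEntry (n i : ℕ) (a b : Fin n) : CInfty F :=
  algebraMap (RatFunc F) (CInfty F) ((logSeries F n).coeff i a b)

theorem logEntry_zero (n : ℕ) (a b : Fin n) : logEntry F n 0 a b = if a = b then 1 else 0 := by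
  rw [logEntry, logSeries_coeff_zero, Matrix.one_apply]
  split_ifs <;> simp

theorem logEntry_succ (n i : ℕ) (a b : Fin n) :
    (theta F - theta F ^ Fintype.card F ^ (i + 1)) * logEntry F n (i + 1) a b =
      (∑ c : Fin n, if (c : ℕ) + 1 = b then logEntry F n (i + 1) a c else 0) -
      (∑ c : Fin n, if (a : ℕ) + 1 = c then logEntry F n (i + 1) c b else 0) +
      ∑ c : Fin n, if (c : ℕ) + 1 = n ∧ (b : ℕ) = 0 then logEntry F n i a c else 0 := by
  have := congrArg (algebraMap (RatFunc F) (CInfty F)) (logSeries_coeff_succ F n i a b)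
  simp only [logEntry, theta]
  simpa only [map_mul, map_sub, map_add, map_sum, map_pow, apply_ite (algebraMap _ _), map_zero]
    using this

theorem theta_sub_pow_ne_zero {i : ℕ} (hi : i ≠ 0) :
    theta F - theta F ^ Fintype.card F ^ i ≠ 0 := by
  rw [← norm_pos_iff, norm_theta_sub_pow F hi]
  have := one_lt_card_real F
  positivity

/-- The last row of `Pᵢ`. -/
theorem logEntry_last (n i : ℕ) (a b : Fin n) (ha : (a : ℕ) + 1 = n) :
    logEntry F n i a b =
      (theta F - theta F ^ Fintype.card F ^ i) ^ (n - 1 - b) / bigL F i ^ n := by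
  induction i generalizing b with
  | zero =>
    -- Here `θ - θ^(q^0) = 0`, so the formula gives the last row of the identity through `0^0 = 1`.
    rw [logEntry_zero]
    have := b.2
    by_cases hab : a = b
    · subst hab
      simp [bigL, show n - 1 - (a : ℕ) = 0 by lia]
    · have : n - 1 - (b : ℕ) ≠ 0 := fun h => hab (Fin.ext (by lia))
      simp [bigL, hab, this]
  | succ i ih =>
    have hc := theta_sub_pow_ne_zero F i.succ_ne_zero
    have hL := bigL_ne_zero F i
    obtain ⟨b, hb⟩ := b
    induction b with
    | zero =>
      -- `N P_(i+1)` has zero last row and `P_(i+1) N` has zero first column, so only the corner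
      -- term survives: the last entry `1 / L_i^n` of the last row of `P_i`.
      have h := logEntry_succ F n i a ⟨0, hb⟩
      rw [sum_eq_zero (by simp), sum_eq_zero fun c _ => if_neg (by have := c.2; lia),
        sum_eq_single a (fun c _ hca => if_neg fun h => hca (Fin.ext (by lia))) (by simp),
        if_pos ⟨ha, rfl⟩, ih, show n - 1 - (a : ℕ) = 0 by lia] at h
      refine mul_left_cancel₀ hc (h.trans ?_)
      obtain ⟨k, rfl⟩ : ∃ k, n = k + 1 := ⟨a, ha.symm⟩
      rw [bigL_succ]
      simp only [add_tsub_cancel_right, tsub_zero, pow_zero, mul_pow]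
      field_simp
      ring
    | succ b ihb =>
      -- Away from the first column only `P_(i+1) N` remains: a step to the right divides by `θ -
      -- θ^(q^(i+1))`.
      have h := logEntry_succ F n i a ⟨b + 1, hb⟩
      rw [sum_eq_single ⟨b, by lia⟩ (fun c _ hcb => if_neg fun h => hcb (Fin.ext (by simpa using h)))
        (by simp), if_pos rfl, sum_eq_zero (s := univ) fun c _ => if_neg (by have := c.2; lia),
        sum_eq_zero (by simp), ihb] at h
      refine mul_left_cancel₀ hc (h.trans ?_)
      have : n - 1 - b = n - 1 - (b + 1) + 1 := by lia
      simp only [this, pow_succ]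
      ring

/-- Above the last row no closed form is needed: the size found there bounds every row, because the
extra term of the recursion, coming from the row below, satisfies the same bound and is then divided
by an element of norm at least `1`. -/
theorem norm_logEntry_le (n i : ℕ) (a b : Fin n) :
    ‖logEntry F n i a b‖ ≤
      ((Fintype.card F : ℝ) ^ Fintype.card F ^ i) ^ (n - 1 - b) / ‖bigL F i‖ ^ n := by
  have h1 := one_lt_card_real F
  have hQ (i : ℕ) : 1 ≤ (Fintype.card F : ℝ) ^ Fintype.card F ^ i := one_le_pow₀ h1.le
  induction i generalizing a b with
  | zero =>
    rw [logEntry_zero]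
    have := one_le_pow₀ (hQ 0) (n := n - 1 - b)
    split_ifs <;> simp [bigL] at this ⊢
    exact this
  | succ i ih =>
    have hsub (x y : CInfty F) : ‖x - y‖ ≤ max ‖x‖ ‖y‖ := by
      simpa [sub_eq_add_neg] using IsUltrametricDist.norm_add_le_max x (-y)
    set Q := (Fintype.card F : ℝ) ^ Fintype.card F ^ (i + 1) with hQdef
    have hQ1 : 1 ≤ Q := hQ (i + 1)
    have hQ0 : 0 < Q := by linarith
    have hL := norm_bigL_pos F i
    have hL' := norm_bigL_pos F (i + 1)
    have hLs : ‖bigL F (i + 1)‖ = ‖bigL F i‖ * Q := by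
      rw [bigL_succ, norm_mul, norm_theta_sub_pow F i.succ_ne_zero]
    -- An entry depends on the one to its left and the one below it, so the double induction runs
    -- over rows from the bottom (`s`) and columns from the left (`b'`).
    have key : ∀ s b' : ℕ, ∀ a b : Fin n, n ≤ a + s → (b : ℕ) < b' →
        ‖logEntry F n (i + 1) a b‖ ≤ Q ^ (n - 1 - b) / ‖bigL F (i + 1)‖ ^ n := by
      intro s
      induction s with
      | zero => intro b' a b h; have := a.2; lia
      | succ s ihs =>
        intro b'
        induction b' with
        | zero => intro a b _ h; lia
        | succ b' ihb =>
          intro a b hs hb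
          have hB : 0 ≤ Q * (Q ^ (n - 1 - b) / ‖bigL F (i + 1)‖ ^ n) := by positivity
          refine le_of_mul_le_mul_left ?_ hQ0
          rw [hQdef, ← norm_theta_sub_pow F i.succ_ne_zero, ← norm_mul, logEntry_succ,
            norm_theta_sub_pow F i.succ_ne_zero, ← hQdef]
          -- By the ultrametric inequality the left neighbour, the lower neighbour and the corner
          -- term can be bounded separately.
          refine (IsUltrametricDist.norm_add_le_max _ _).trans (max_le
            ((hsub _ _).trans (max_le ?_ ?_)) ?_) <;>
          refine IsUltrametricDist.norm_sum_le_of_forall_le_of_nonneg hB fun c _ => ?_ <;>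
          split_ifs with hc
          on_goal 2 => simpa using hB
          on_goal 3 => simpa using hB
          on_goal 4 => simpa using hB
          · refine (ihb a c hs (by lia)).trans (le_of_eq ?_)
            rw [show n - 1 - (c : ℕ) = n - 1 - b + 1 by have := b.2; lia, pow_succ]
            ring
          · refine (ihs (b + 1) c b (by lia) (by lia)).trans ?_
            exact le_mul_of_one_le_left (by positivity) hQ1
          · refine (ih a c).trans (le_of_eq ?_)
            obtain ⟨k, rfl⟩ : ∃ k, n = k + 1 := ⟨c, hc.1.symm⟩
            rw [hLs, hc.2, show k + 1 - 1 - (c : ℕ) = 0 by lia, mul_pow]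
            simp only [add_tsub_cancel_right, tsub_zero, pow_zero]
            field_simp
            ring
    exact key n (b + 1) a b (by lia) (by lia)

theorem logTerm_apply (n : ℕ) (x : Fin n → CInfty F) (i : ℕ) (a : Fin n) :
    logTerm F n x i a = ∑ b, logEntry F n i a b * x b ^ Fintype.card F ^ i := rfl

variable {F} in
theorem summable_logTerm {n : ℕ} {x : Fin n → CInfty F}
    (hx : ∀ b : Fin n, ‖x b‖ * (Fintype.card F : ℝ) ^ (n - 1 - b) < logRadius F ^ n) :
    Summable (logTerm F n x) := by
  rw [Pi.summable]
  intro a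
  simp only [logTerm_apply]
  refine summable_sum fun b _ => ?_
  refine .of_norm_bounded (summable_pow_div_norm_bigL F n (by positivity) (hx b)) fun i => ?_
  rw [norm_mul, norm_pow]
  refine (mul_le_mul_of_nonneg_right (norm_logEntry_le F n i a b) (by positivity)).trans
    (le_of_eq ?_)
  rw [mul_pow, ← pow_mul, ← pow_mul]
  ring

variable {F} in
theorem summable_polylogTerm {n : ℕ} {z : CInfty F} (hz : ‖z‖ < logRadius F ^ n) :
    Summable (polylogTerm F n z) := by
  refine .of_norm_bounded (summable_pow_div_norm_bigL F n (norm_nonneg z) hz) fun i => ?_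
  simp [polylogTerm]

end LogCoeff

/-! ### Gauss norms of power series and evaluation at a point -/

section GaussBound

variable {K : Type*} [NormedField K]

/-- The Gauss norm of radius `R` of the power series `g` is at most `B`. -/
def GaussBound (R : ℝ) (g : K⟦X⟧) (B : ℝ) : Prop :=
  ∀ m, ‖PowerSeries.coeff m g‖ * R ^ m ≤ B

namespace GaussBound

variable {R B B' : ℝ} {g h : K⟦X⟧}

theorem nonneg (hg : GaussBound R g B) : 0 ≤ B := by
  have := hg 0
  rw [pow_zero, mul_one] at this
  exact (norm_nonneg _).trans this

theorem mono (hg : GaussBound R g B) (h : B ≤ B') : GaussBound R g B' := fun m => (hg m).trans h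

theorem sum {ι : Type*} {s : Finset ι} {g : ι → K⟦X⟧} {B : ι → ℝ} (hR : 0 ≤ R)
    (h : ∀ i ∈ s, GaussBound R (g i) (B i)) : GaussBound R (∑ i ∈ s, g i) (∑ i ∈ s, B i) := by
  intro m
  rw [map_sum]
  calc _ ≤ (∑ i ∈ s, ‖PowerSeries.coeff m (g i)‖) * R ^ m := by
        gcongr
        exact norm_sum_le _ _
    _ ≤ _ := by
        rw [sum_mul]
        exact sum_le_sum fun i hi => h i hi m

theorem const (a : K) : GaussBound R (PowerSeries.C a) ‖a‖ := by
  intro m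
  rw [PowerSeries.coeff_C]
  split_ifs with hm
  · simp [hm]
  · simp

theorem X_sub_C (a : K) : GaussBound R (PowerSeries.X - PowerSeries.C a) (max R ‖a‖) := by
  intro m
  rcases m with _ | _ | m <;> simp [PowerSeries.coeff_X]

/-- The inverse is the geometric series `-∑ t^m / a^(m+1)`, whose coefficients times `R^m` have size
`|a|⁻¹ (R/|a|)^m`. -/
theorem inv_X_sub_C (hR : 0 < R) {a : K} (ha : R ≤ ‖a‖) :
    GaussBound R (PowerSeries.X - PowerSeries.C a)⁻¹ ‖a‖⁻¹ := by
  have ha0 : 0 < ‖a‖ := hR.trans_le ha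
  have ha' : a ≠ 0 := norm_pos_iff.1 ha0
  have : (PowerSeries.X - PowerSeries.C a)⁻¹ = PowerSeries.mk fun m => -(a⁻¹ ^ (m + 1)) := by
    rw [PowerSeries.inv_eq_iff_mul_eq_one (by simpa using ha')]
    ext m
    rw [mul_comm, sub_mul, map_sub, PowerSeries.coeff_C_mul, PowerSeries.coeff_one]
    cases m with
    | zero => simp [ha']
    | succ m =>
      rw [PowerSeries.coeff_succ_X_mul]
      simp [pow_succ]
      field_simp
      simp
  intro m
  rw [this, PowerSeries.coeff_mk, norm_neg, norm_pow, norm_inv, pow_succ, mul_right_comm, ← mul_pow,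
    inv_mul_eq_div]
  exact mul_le_of_le_one_left (by positivity)
    (pow_le_one₀ (by positivity) ((div_le_one ha0).2 ha))

variable [IsUltrametricDist K]

theorem mul (hR : 0 < R) (hg : GaussBound R g B) (hh : GaussBound R h B') :
    GaussBound R (g * h) (B * B') := by
  intro m
  have hB := hg.nonneg
  have hB' := hh.nonneg
  rw [← le_div_iff₀ (by positivity), PowerSeries.coeff_mul]
  refine IsUltrametricDist.norm_sum_le_of_forall_le_of_nonneg (by positivity) ?_
  rintro ⟨a, b⟩ hab
  rw [Finset.HasAntidiagonal.mem_antidiagonal] at hab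
  simp only at hab
  rw [le_div_iff₀ (by positivity), ← hab, norm_mul, pow_add, mul_mul_mul_comm]
  exact mul_le_mul (hg a) (hh b) (by positivity) hB

theorem pow (hR : 0 < R) (hg : GaussBound R g B) (n : ℕ) : GaussBound R (g ^ n) (B ^ n) := by
  induction n with
  | zero => simpa using const (R := R) (1 : K)
  | succ n ih =>
    rw [pow_succ, pow_succ]
    exact ih.mul hR hg

end GaussBound

theorem powerSeries_inv_pow (g : K⟦X⟧) (n : ℕ) : (g ^ n)⁻¹ = g⁻¹ ^ n := by
  induction n with
  | zero => simp
  | succ n ih => rw [pow_succ, PowerSeries.mul_inv_rev, ih, pow_succ']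

/-- Evaluation at `x` is multiplicative on absolutely convergent series, by the Cauchy product. -/
theorem tsum_coeff_mul_mul_pow [CompleteSpace K] {g h : K⟦X⟧} {x : K}
    (hg : Summable fun m => ‖PowerSeries.coeff m g * x ^ m‖)
    (hh : Summable fun m => ‖PowerSeries.coeff m h * x ^ m‖) :
    ∑' m, PowerSeries.coeff m (g * h) * x ^ m =
      (∑' m, PowerSeries.coeff m g * x ^ m) * ∑' m, PowerSeries.coeff m h * x ^ m := by
  rw [tsum_mul_tsum_eq_tsum_sum_antidiagonal_of_summable_norm hg hh]
  congr 1
  funext m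
  rw [PowerSeries.coeff_mul, sum_mul]
  refine sum_congr rfl fun y hy => ?_
  rw [← Finset.HasAntidiagonal.mem_antidiagonal.1 hy, pow_add]
  ring

theorem hasSum_coeff_coe_mul_pow (f : K[X]) (x : K) :
    HasSum (fun m => PowerSeries.coeff m (f : K⟦X⟧) * x ^ m) (f.eval x) := by
  rw [eval_eq_sum_range]
  simp only [coeff_coe]
  refine hasSum_sum_of_ne_finset_zero fun m hm => ?_
  rw [coeff_eq_zero_of_natDegree_lt (by simpa [Nat.lt_succ_iff] using hm), zero_mul]

theorem summable_norm_coeff_coe_mul_pow (f : K[X]) (x : K) :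
    Summable fun m => ‖PowerSeries.coeff m (f : K⟦X⟧) * x ^ m‖ := by
  refine summable_of_ne_finset_zero (s := range (f.natDegree + 1)) fun m hm => ?_
  rw [coeff_coe, coeff_eq_zero_of_natDegree_lt (by simpa [Nat.lt_succ_iff] using hm), zero_mul,
    norm_zero]

end GaussBound

/-! ### The deformation series, its value at `θ`, and the comparison -/

section Motivic

variable {F : Type*} [Field F] [Fintype F]

theorem frobenius_pow_apply (i : ℕ) (x : CInfty F) :
    (FiniteField.frobeniusAlgHom F (CInfty F) ^ i) x = x ^ Fintype.card F ^ i := by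
  rw [AlgHom.coe_pow, FiniteField.coe_frobeniusAlgHom, pow_iterate]

/-- The polynomial `∑_{j < n} p_j (t - θ) ^ j` over `ℂ_∞`. -/
def thetaExpansion (n : ℕ) (p : ℕ → CInfty F) : (CInfty F)[X] :=
  ∑ j ∈ range n, C (p j) * (X - C (theta F)) ^ j

theorem map_pointPoly (n : ℕ) (p : ℕ → KBar F) :
    (pointPoly n p).map (algebraMap (KBar F) (CInfty F)) =
      thetaExpansion n fun j => (p j : CInfty F) := by
  simp only [pointPoly, thetaExpansion, Polynomial.map_sum, Polynomial.map_mul, Polynomial.map_pow,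
    Polynomial.map_sub, map_C, map_X]
  rfl

theorem twist_thetaExpansion (n : ℕ) (p : ℕ → CInfty F) (i : ℕ) :
    twist (thetaExpansion n p) i = ∑ j ∈ range n,
      C (p j ^ Fintype.card F ^ i) * (X - C (theta F ^ Fintype.card F ^ i)) ^ j := by
  have h (x : CInfty F) : (FiniteField.frobeniusAlgHom F (CInfty F) ^ i :
      CInfty F →ₐ[F] CInfty F).toRingHom x = x ^ Fintype.card F ^ i := frobenius_pow_apply i x
  simp only [twist, thetaExpansion, Polynomial.map_sum, Polynomial.map_mul, Polynomial.map_pow,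
    Polynomial.map_sub, map_C, map_X, h]

theorem eval_twist_thetaExpansion (n : ℕ) (p : ℕ → CInfty F) (i : ℕ) :
    (twist (thetaExpansion n p) i).eval (theta F) = ∑ j ∈ range n,
      p j ^ Fintype.card F ^ i * (theta F - theta F ^ Fintype.card F ^ i) ^ j := by
  simp [twist_thetaExpansion, eval_finsetSum]

theorem eval_motivicL (i : ℕ) : (motivicL F i).eval (theta F) = bigL F i := by
  simp only [motivicL, bigL, eval_prod, eval_sub, eval_X, eval_C]

theorem constantCoeff_motivicL_ne_zero (i : ℕ) :
    PowerSeries.constantCoeff (motivicL F i : (CInfty F)⟦X⟧) ≠ 0 := by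
  have ht : theta F ≠ 0 := by
    rw [← norm_pos_iff, norm_theta]
    exact zero_lt_one.trans (one_lt_card_real F)
  rw [← PowerSeries.coeff_zero_eq_constantCoeff_apply, coeff_coe, coeff_zero_eq_eval_zero, motivicL,
    eval_prod, prod_ne_zero_iff]
  simp [ht]

/-- The radius `q^2` exceeds `|θ| = q`, leaving room to evaluate at `θ`, yet is at most `q^q`, the
norm of the smallest possible zero `θ^q` of `𝕃_i`. So the bound is still `1 / |L_i|`. -/
theorem gaussBound_inv_motivicL (i : ℕ) :
    GaussBound ((Fintype.card F : ℝ) ^ 2) (motivicL F i : (CInfty F)⟦X⟧)⁻¹ ‖bigL F i‖⁻¹ := by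
  have h1 := one_lt_card_real F
  have hR : 0 < (Fintype.card F : ℝ) ^ 2 := by positivity
  induction i with
  | zero => simpa [motivicL, bigL] using GaussBound.const (1 : CInfty F)
  | succ i ih =>
    have : motivicL F (i + 1) = motivicL F i * (X - C (theta F ^ Fintype.card F ^ (i + 1))) :=
      prod_Icc_succ_top (by lia) _
    have hθ : ‖theta F ^ Fintype.card F ^ (i + 1)‖ =
        (Fintype.card F : ℝ) ^ Fintype.card F ^ (i + 1) := by rw [norm_pow, norm_theta]
    rw [this, Polynomial.coe_mul, PowerSeries.mul_inv_rev, bigL_succ, norm_mul, mul_inv_rev, Polynomial.coe_sub, Polynomial.coe_X,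
      Polynomial.coe_C, norm_theta_sub_pow F i.succ_ne_zero, ← hθ]
    refine (GaussBound.inv_X_sub_C hR ?_).mul hR ih
    rw [hθ]
    refine pow_le_pow_right₀ h1.le ?_
    have h2 : 2 ≤ Fintype.card F := Fintype.one_lt_card
    exact h2.trans (Nat.le_self_pow i.succ_ne_zero _)

theorem gaussBound_motivicTerm (n : ℕ) (p : ℕ → CInfty F) (i : ℕ) :
    GaussBound ((Fintype.card F : ℝ) ^ 2) (motivicTerm (thetaExpansion n p) n i)
      (∑ j ∈ range n, (Fintype.card F : ℝ) ^ j *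
        ((‖p j‖ * (Fintype.card F : ℝ) ^ j) ^ Fintype.card F ^ i / ‖bigL F i‖ ^ n)) := by
  have h1 := one_lt_card_real F
  set q : ℝ := (Fintype.card F : ℝ) with hq
  have hR : 0 < q ^ 2 := by positivity
  have hX : GaussBound (q ^ 2)
      ((PowerSeries.X : (CInfty F)⟦X⟧) - PowerSeries.C (theta F ^ Fintype.card F ^ i))
      (q * q ^ Fintype.card F ^ i) := by
    -- The factor `q` covers `i = 0`, where the radius `q^2` exceeds `|θ|`. It costs only `q^j` in
    -- the final bound, independently of `i`.
    refine (GaussBound.X_sub_C _).mono (max_le ?_ ?_)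
    · rw [pow_two]
      gcongr
      exact le_self_pow₀ h1.le (pow_pos Fintype.card_pos _).ne'
    · rw [norm_pow, norm_theta]
      exact le_mul_of_one_le_left (by positivity) h1.le
  have hs : GaussBound (q ^ 2) (twist (thetaExpansion n p) i : (CInfty F)⟦X⟧)
      (∑ j ∈ range n, q ^ j * (‖p j‖ * q ^ j) ^ Fintype.card F ^ i) := by
    rw [twist_thetaExpansion, ← coeToPowerSeries.ringHom_apply, map_sum]
    refine GaussBound.sum hR.le fun j _ => ?_
    rw [coeToPowerSeries.ringHom_apply, Polynomial.coe_mul, Polynomial.coe_pow, Polynomial.coe_sub, Polynomial.coe_X, Polynomial.coe_C, Polynomial.coe_C]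
    refine ((GaussBound.const _).mul hR (hX.pow hR j)).mono (le_of_eq ?_)
    rw [norm_pow]
    ring
  rw [motivicTerm, powerSeries_inv_pow]
  refine (hs.mul hR ((gaussBound_inv_motivicL i).pow hR n)).mono (le_of_eq ?_)
  rw [sum_mul]
  refine sum_congr rfl fun j _ => ?_
  rw [inv_pow]
  ring

/-- Clearing the denominator `𝕃_i^n` leaves a polynomial identity, which may be evaluated at `θ`. -/
theorem tsum_evalThetaTerm_motivicTerm (f : (CInfty F)[X]) (n i : ℕ)
    (h : Summable fun m => ‖evalThetaTerm (motivicTerm f n i) m‖) :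
    ∑' m, evalThetaTerm (motivicTerm f n i) m = (twist f i).eval (theta F) / bigL F i ^ n := by
  have hc : PowerSeries.constantCoeff ((motivicL F i : (CInfty F)⟦X⟧) ^ n) ≠ 0 := by
    rw [map_pow]
    exact pow_ne_zero _ (constantCoeff_motivicL_ne_zero i)
  have hm : motivicTerm f n i * ((motivicL F i ^ n : (CInfty F)[X]) : (CInfty F)⟦X⟧) =
      (twist f i : (CInfty F)⟦X⟧) := by
    rw [motivicTerm, Polynomial.coe_pow, mul_assoc, PowerSeries.inv_mul_cancel _ hc, mul_one]
  rw [eq_div_iff (pow_ne_zero _ (bigL_ne_zero F i)), ← eval_motivicL, ← eval_pow,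
    ← (hasSum_coeff_coe_mul_pow _ _).tsum_eq, ← (hasSum_coeff_coe_mul_pow (twist f i) _).tsum_eq,
    ← hm, tsum_coeff_mul_mul_pow h (summable_norm_coeff_coe_mul_pow _ _)]
  rfl

/-- The domain of convergence of the Carlitz logarithm, in the coordinates `p_0, …, p_{n-1}`. -/
def InLogDomain (n : ℕ) (p : ℕ → CInfty F) : Prop :=
  ∀ j < n, ‖p j‖ * (Fintype.card F : ℝ) ^ j < logRadius F ^ n

theorem InLogDomain.summable_bound {n : ℕ} {p : ℕ → CInfty F} (hp : InLogDomain n p) :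
    Summable fun i => ∑ j ∈ range n, (Fintype.card F : ℝ) ^ j *
      ((‖p j‖ * (Fintype.card F : ℝ) ^ j) ^ Fintype.card F ^ i / ‖bigL F i‖ ^ n) :=
  summable_sum fun j hj =>
    (summable_pow_div_norm_bigL F n (by positivity) (hp j (mem_range.1 hj))).mul_left _

open scoped PowerSeries.WithPiTopology in
theorem InLogDomain.summable_motivicTerm {n : ℕ} {p : ℕ → CInfty F} (hp : InLogDomain n p) :
    Summable (motivicTerm (thetaExpansion n p) n) := by
  rw [PowerSeries.WithPiTopology.summable_iff_summable_coeff]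
  intro m
  refine .of_norm_bounded hp.summable_bound fun i => ?_
  refine le_trans ?_ (gaussBound_motivicTerm n p i m)
  exact le_mul_of_one_le_right (norm_nonneg _)
    (one_le_pow₀ (one_le_pow₀ (one_lt_card_real F).le))

/-- Passing from radius `q^2` to `|θ| = q` gains `q^(-m)`, so the double family is dominated by a
product of two summable families. This justifies exchanging the sums. -/
theorem InLogDomain.summable_norm_evalThetaTerm {n : ℕ} {p : ℕ → CInfty F}
    (hp : InLogDomain n p) :
    Summable fun x : ℕ × ℕ => ‖evalThetaTerm (motivicTerm (thetaExpansion n p) n x.1) x.2‖ := by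
  have h1 := one_lt_card_real F
  have hg : Summable fun m : ℕ => (Fintype.card F : ℝ)⁻¹ ^ m :=
    summable_geometric_of_lt_one (by positivity) (inv_lt_one_of_one_lt₀ h1)
  refine (hp.summable_bound.mul_of_nonneg hg (fun i => sum_nonneg fun j _ => by positivity)
    fun m => by positivity).of_nonneg_of_le (fun _ => norm_nonneg _) fun x => ?_
  rw [evalThetaTerm, norm_mul, norm_pow, norm_theta, inv_pow, ← div_eq_mul_inv,
    le_div_iff₀ (by positivity), mul_assoc, ← pow_two, ← pow_mul, mul_comm _ 2, pow_mul]
  exact gaussBound_motivicTerm n p x.1 x.2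

open scoped PowerSeries.WithPiTopology in
theorem InLogDomain.evalThetaTerm_motivicSeries {n : ℕ} {p : ℕ → CInfty F}
    (hp : InLogDomain n p) (m : ℕ) :
    evalThetaTerm (motivicSeries (thetaExpansion n p) n) m =
      ∑' i, evalThetaTerm (motivicTerm (thetaExpansion n p) n i) m := by
  have := (PowerSeries.WithPiTopology.hasSum_iff_hasSum_coeff _).1 hp.summable_motivicTerm.hasSum m
  simp only [evalThetaTerm]
  rw [tsum_mul_right, this.tsum_eq]
  rfl

theorem InLogDomain.summable_evalThetaTerm {n : ℕ} {p : ℕ → CInfty F} (hp : InLogDomain n p) :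
    Summable (evalThetaTerm (motivicSeries (thetaExpansion n p) n)) := by
  rw [funext hp.evalThetaTerm_motivicSeries]
  exact hp.summable_norm_evalThetaTerm.of_norm.prod_symm.prod

theorem InLogDomain.evalTheta_motivicSeries {n : ℕ} {p : ℕ → CInfty F} (hp : InLogDomain n p) :
    evalTheta (motivicSeries (thetaExpansion n p) n) =
      ∑' i, (twist (thetaExpansion n p) i).eval (theta F) / bigL F i ^ n := by
  rw [evalTheta, funext hp.evalThetaTerm_motivicSeries,
    Summable.tsum_comm (f := fun i => evalThetaTerm (motivicTerm (thetaExpansion n p) n i))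
      hp.summable_norm_evalThetaTerm.of_norm]
  congr 1
  funext i
  exact tsum_evalThetaTerm_motivicTerm _ _ _ (hp.summable_norm_evalThetaTerm.prod_factor i)

theorem InLogDomain.summable_logTerm {n : ℕ} {p : ℕ → CInfty F} (hp : InLogDomain n p) :
    Summable (logTerm F n fun b => p (n - 1 - b)) :=
  Carlitz.summable_logTerm fun b => hp _ (by have := b.2; lia)

theorem InLogDomain.log_last {n : ℕ} {p : ℕ → CInfty F} (hp : InLogDomain n p) (a : Fin n)
    (ha : (a : ℕ) + 1 = n) :
    log F n (fun b => p (n - 1 - b)) a =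
      ∑' i, (twist (thetaExpansion n p) i).eval (theta F) / bigL F i ^ n := by
  rw [log, tsum_apply hp.summable_logTerm]
  congr 1
  funext i
  -- Coordinate `b` of the point is `p_j` with `j = n - 1 - b`, the exponent in the last row of
  -- `P_i`.
  rw [logTerm_apply, eval_twist_thetaExpansion, ← sum_range_reflect, sum_range, sum_div]
  refine sum_congr rfl fun b _ => ?_
  rw [logEntry_last F n i a b ha]
  ring

theorem InLogDomain.summable_polylogTerm {n : ℕ} {p : ℕ → CInfty F} (hp : InLogDomain n p)
    {j m : ℕ} (hj : j < n) (hm : m ≤ j) : Summable (polylogTerm F n (theta F ^ m * p j)) := by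
  refine Carlitz.summable_polylogTerm (lt_of_le_of_lt ?_ (hp j hj))
  rw [norm_mul, norm_pow, norm_theta, mul_comm]
  gcongr
  exact (one_lt_card_real F).le

/-- This is the binomial expansion of `(θ - θ^(q^i))^j`: the factor `θ^(m q^i)` comes from `(θ^m
x)^(q^i)`, while `θ^(j-m)` does not depend on `i` and stays outside as a coefficient. -/
theorem sum_smul_polylogTerm (n j i : ℕ) (x : CInfty F) :
    ∑ m ∈ range (j + 1), ((-1 : RatFunc F) ^ m * (j.choose m : RatFunc F) * RatFunc.X ^ (j - m)) •
        polylogTerm F n (theta F ^ m * x) i =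
      x ^ Fintype.card F ^ i * (theta F - theta F ^ Fintype.card F ^ i) ^ j / bigL F i ^ n := by
  rw [sub_eq_neg_add, add_pow, mul_sum, sum_div]
  refine sum_congr rfl fun m _ => ?_
  rw [Algebra.smul_def, polylogTerm, neg_pow (theta F ^ _)]
  simp only [map_mul, map_pow, map_neg, map_one, map_natCast, mul_pow, theta]
  ring

theorem InLogDomain.sum_smul_polylog {n : ℕ} {p : ℕ → CInfty F} (hp : InLogDomain n p) :
    ∑ j ∈ Icc 1 n, ∑ m ∈ range (n - j + 1),
        ((-1 : RatFunc F) ^ m * ((n - j).choose m : RatFunc F) * RatFunc.X ^ (n - m - j)) •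
          polylog F n (theta F ^ m * p (n - j)) =
      ∑' i, (twist (thetaExpansion n p) i).eval (theta F) / bigL F i ^ n := by
  have hs : ∀ j ∈ range n, ∀ m ∈ range (j + 1), Summable fun i =>
      ((-1 : RatFunc F) ^ m * (j.choose m : RatFunc F) * RatFunc.X ^ (j - m)) •
        polylogTerm F n (theta F ^ m * p j) i := by
    intro j hj m hm
    simp only [Algebra.smul_def]
    exact (hp.summable_polylogTerm (mem_range.1 hj) (by simpa [Nat.lt_succ_iff] using hm)).mul_left _
  calc _ = ∑ j ∈ range n, ∑ m ∈ range (j + 1),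
        ((-1 : RatFunc F) ^ m * (j.choose m : RatFunc F) * RatFunc.X ^ (j - m)) •
          polylog F n (theta F ^ m * p j) := by
        -- The substitution `j ↦ n - j` turns the exponent `n - m - j` into `j - m`.
        refine sum_nbij' (fun j => n - j) (fun j => n - j) ?_ ?_ ?_ ?_ ?_ <;>
          intro j hj <;> simp only [mem_Icc, mem_range] at hj ⊢ <;> lia
    _ = ∑ j ∈ range n, ∑' i, ∑ m ∈ range (j + 1),
        ((-1 : RatFunc F) ^ m * (j.choose m : RatFunc F) * RatFunc.X ^ (j - m)) •
          polylogTerm F n (theta F ^ m * p j) i := by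
        refine sum_congr rfl fun j hj => ?_
        rw [Summable.tsum_finsetSum (hs j hj)]
        refine sum_congr rfl fun m _ => ?_
        simp only [Algebra.smul_def, tsum_mul_left]
        rfl
    _ = _ := by
        rw [← Summable.tsum_finsetSum fun j hj => summable_sum (hs j hj)]
        congr 1
        funext i
        rw [eval_twist_thetaExpansion, sum_div]
        exact sum_congr rfl fun j _ => sum_smul_polylogTerm n j i (p j)

end Motivic

end Carlitz

end

open scoped PowerSeries.WithPiTopology in
theorem mainTheorem7 {F : Type*} [Field F] [Fintype F] (n : ℕ) (hn : 0 < n)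
    (p : ℕ → Carlitz.KBar F)
    (hp : ∀ j < n, ‖(p j : Carlitz.CInfty F)‖ <
      (Fintype.card F : ℝ) ^ (-(j : ℝ) + n * Fintype.card F / ((Fintype.card F : ℝ) - 1))) :
    -- all the series that occur converge
    Summable (Carlitz.logTerm F n (fun i => (Carlitz.point n p i : Carlitz.CInfty F))) ∧
    (∀ j < n, ∀ m ≤ j, Summable
      (Carlitz.polylogTerm F n (Carlitz.theta F ^ m * (p j : Carlitz.CInfty F)))) ∧
    Summable (Carlitz.motivicTerm
      ((Carlitz.pointPoly n p).map (algebraMap (Carlitz.KBar F) (Carlitz.CInfty F))) n) ∧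
    Summable (Carlitz.evalThetaTerm (Carlitz.motivicSeries
      ((Carlitz.pointPoly n p).map (algebraMap (Carlitz.KBar F) (Carlitz.CInfty F))) n)) ∧
    -- the last coordinate of the logarithm as a `k`-linear combination of polylogarithms
    Carlitz.log F n (fun i => (Carlitz.point n p i : Carlitz.CInfty F))
        ⟨n - 1, Nat.sub_lt hn one_pos⟩ =
      ∑ j ∈ Finset.Icc 1 n, ∑ m ∈ Finset.range (n - j + 1),
        ((-1 : RatFunc F) ^ m * ((n - j).choose m : RatFunc F) * RatFunc.X ^ (n - m - j)) •
          Carlitz.polylog F n (Carlitz.theta F ^ m * (p (n - j) : Carlitz.CInfty F)) ∧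
    -- the same combination as a value of the deformation series
    ∑ j ∈ Finset.Icc 1 n, ∑ m ∈ Finset.range (n - j + 1),
        ((-1 : RatFunc F) ^ m * ((n - j).choose m : RatFunc F) * RatFunc.X ^ (n - m - j)) •
          Carlitz.polylog F n (Carlitz.theta F ^ m * (p (n - j) : Carlitz.CInfty F)) =
      Carlitz.evalTheta (Carlitz.motivicSeries
        ((Carlitz.pointPoly n p).map (algebraMap (Carlitz.KBar F) (Carlitz.CInfty F))) n) := by
  have hd : Carlitz.InLogDomain n fun j => (p j : Carlitz.CInfty F) := fun j hj =>
    Carlitz.mul_pow_lt_logRadius_pow F n j (hp j hj)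
  -- Both right-hand sides become the common series `∑ i, f^(i)(θ) / L_i^n`.
  rw [Carlitz.map_pointPoly, hd.evalTheta_motivicSeries, hd.sum_smul_polylog]
  exact ⟨hd.summable_logTerm, fun j hj m hm => hd.summable_polylogTerm hj hm,
    hd.summable_motivicTerm, hd.summable_evalThetaTerm,
    hd.log_last ⟨n - 1, _⟩ (Nat.sub_add_cancel hn), rfl⟩
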